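/- All graphs are finite and simple. A graph is traceable if it has a path through all of its vertices, and a path factor of a graph $G$ is a spanning subgraph of $G$ each of whose connected components is isomorphic to a path with at least two vertices. Let $\Delta(G)$ denote the maximum degree of $G$, and let $G_1\square G_2$ denote the Cartesian product: the graph with vertex set $V(G_1)\times V(G_2)$ in which $(v,u)$ and $(v',u')$ are adjacent if and only if either $u=u'$ and $vv'\in E(G_1)$, or $v=v'$ and $uu'\in E(G_2)$. Theorem. Let $G_1$ be a traceable graph and $G_2$ a connected graph, and exclude the degenerate case $|V(G_1)|=1$, $|V(G_2)|=2$. Suppose that at least one of the following holds: (a) $G_2$ has a perfect matching and $|V(G_1)|\ge\Delta(G_2)$; (b) $G_2$ has a path factor, $|V(G_1)|$ is even, and $|V(G_1)|\ge 4\Delta(G_2)-2$. Then $G_1\square G_2$ has a Hamiltonian cycle, that is, a cycle (of length at least $3$) through all of its vertices. -/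

import Mathlib

namespace SimpleGraph

/-- A graph is traceable if it contains a spanning (Hamiltonian) path. -/
def IsTraceable {V : Type*} [DecidableEq V] (G : SimpleGraph V) : Prop :=
  ∃ (a b : V) (p : G.Walk a b), p.IsHamiltonian

/-- `F` is a path factor of `G`: a spanning subgraph of `G` (a graph on the same vertex set, all
of whose edges are edges of `G`) such that each connected component of `F` is isomorphic to a path
of order at least two. -/
def IsPathFactor {V : Type*} (G F : SimpleGraph V) : Prop :=
  F ≤ G ∧ ∀ C : F.ConnectedComponent, ∃ k : ℕ, 2 ≤ k ∧ Nonempty (C.toSimpleGraph ≃g pathGraph k)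

/-- `G` has a path factor. -/
def HasPathFactor {V : Type*} (G : SimpleGraph V) : Prop :=
  ∃ F : SimpleGraph V, G.IsPathFactor F

/-- `G` has a perfect matching. -/
def HasPerfectMatching {V : Type*} (G : SimpleGraph V) : Prop :=
  ∃ M : G.Subgraph, M.IsPerfectMatching

/-- `G` has a Hamiltonian cycle, that is, a cycle (of length at least three) through every
vertex. -/
def HasHamiltonianCycle {V : Type*} [DecidableEq V] (G : SimpleGraph V) : Prop :=
  ∃ (a : V) (p : G.Walk a a), p.IsHamiltonianCycle

end SimpleGraph

/-! A Hamiltonian path of `G₁` makes every vertex of `G₂` a column, namely a copy of that path. Cut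
`V(G₂)` into blocks: the edges of the perfect matching, or pieces of two or three consecutive
vertices of the path factor. The columns of each block carry a spanning cycle: a rectangle for two,
a snake for three (this needs an even number of rows).

If `w` and `u` are adjacent in `G₂` and two disjoint cycles both use the column edge between rows
`j` and `j + 1`, over `w` and over `u` respectively, then exchanging these edges for the rungs in
rows `j` and `j + 1` merges the cycles (`IsCycleOn.merge`). Each merge spends one column edge over
each of `w` and `u`. The core is `IsPathEnum.hasHamiltonianCycle_of_blocks`: connectedness of `G₂`
supplies merges until one cycle remains, and edges never run out if adjacent columns initially share
at least `Δ(G₂) - 1` of them.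

Matching edges share all `n - 1` column edges. In the snakes the pattern has period 4 and any two
columns share a residue class mod 4, hence the bound `4Δ - 2`. -/

namespace SimpleGraph

/-! ### Building, closing and merging paths and cycles with prescribed edges. -/

variable {V : Type*} {G : SimpleGraph V} {S T : Set V} {E F : Set (Sym2 V)} {x y z w : V}

/-- `G` has a path from `x` to `y` with vertex set `S`, using every edge in `E`. -/
def IsPathOn (G : SimpleGraph V) (S : Set V) (E : Set (Sym2 V)) (x y : V) : Prop :=
  ∃ p : G.Walk x y, p.IsPath ∧ (∀ v, v ∈ p.support ↔ v ∈ S) ∧ ∀ e ∈ E, e ∈ p.edges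

/-- `G` has a cycle with vertex set `S`, using every edge in `E`. -/
def IsCycleOn (G : SimpleGraph V) (S : Set V) (E : Set (Sym2 V)) : Prop :=
  ∃ (a : V) (p : G.Walk a a), p.IsCycle ∧ (∀ v, v ∈ p.support ↔ v ∈ S) ∧ ∀ e ∈ E, e ∈ p.edges

theorem isPathOn_singleton (x : V) : G.IsPathOn {x} ∅ x x :=
  ⟨.nil, by simp⟩

theorem IsPathOn.mono (h : G.IsPathOn S E x y) (hST : ∀ v, v ∈ T ↔ v ∈ S) (hFE : F ⊆ E) :
    G.IsPathOn T F x y := by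
  obtain ⟨p, hp, hs, he⟩ := h
  exact ⟨p, hp, fun v => (hs v).trans (hST v).symm, fun e h => he e (hFE h)⟩

theorem IsCycleOn.mono (h : G.IsCycleOn S E) (hST : ∀ v, v ∈ T ↔ v ∈ S) (hFE : F ⊆ E) :
    G.IsCycleOn T F := by
  obtain ⟨a, p, hp, hs, he⟩ := h
  exact ⟨a, p, hp, fun v => (hs v).trans (hST v).symm, fun e h => he e (hFE h)⟩

theorem IsPathOn.symm (h : G.IsPathOn S E x y) : G.IsPathOn S E y x := by
  obtain ⟨p, hp, hs, he⟩ := h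
  exact ⟨p.reverse, hp.reverse, by simpa using hs, by simpa using he⟩

theorem IsPathOn.append (h : G.IsPathOn S E x y) (h' : G.IsPathOn T F z w) (hyz : G.Adj y z)
    (hST : Disjoint S T) : G.IsPathOn (S ∪ T) (insert s(y, z) (E ∪ F)) x w := by
  obtain ⟨p, hp, hs, he⟩ := h
  obtain ⟨q, hq, hs', he'⟩ := h'
  refine ⟨p.append (.cons hyz q), ?_, ?_, ?_⟩
  · rw [Walk.isPath_def, Walk.support_append, Walk.support_cons, List.tail_cons,
      List.nodup_append']
    refine ⟨hp.support_nodup, hq.support_nodup, fun v hv hv' => ?_⟩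
    exact Set.disjoint_left.1 hST ((hs v).1 hv) ((hs' v).1 hv')
  · intro v
    rw [Walk.support_append, Walk.support_cons, List.tail_cons, List.mem_append, hs, hs']
    rfl
  · intro e h
    rw [Walk.edges_append, Walk.edges_cons, List.mem_append, List.mem_cons]
    rcases h with h | h | h
    · exact .inr (.inl h)
    · exact .inl (he e h)
    · exact .inr (.inr (he' e h))

theorem IsPathOn.cons (h : G.IsPathOn S E x y) (hwx : G.Adj w x) (hw : w ∉ S) :
    G.IsPathOn (insert w S) (insert s(w, x) E) w y :=
  ((isPathOn_singleton w).append h hwx (by simpa using hw)).mono (by simp) (by simp)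

theorem IsPathOn.concat (h : G.IsPathOn S E x y) (hyw : G.Adj y w) (hw : w ∉ S) :
    G.IsPathOn (insert w S) (insert s(y, w) E) x w :=
  (h.append (isPathOn_singleton w) hyw (by simpa using hw)).mono (by simp) (by simp)

/-- The third vertex rules out the path consisting of the edge `xy` alone, the only path that
already uses the closing edge. -/
theorem IsPathOn.close (h : G.IsPathOn S E x y) (hxy : G.Adj x y)
    (hS : ∃ v ∈ S, v ≠ x ∧ v ≠ y) : G.IsCycleOn S E := by
  obtain ⟨p, hp, hs, he⟩ := h
  obtain ⟨v, hv, hvx, hvy⟩ := hS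
  refine ⟨y, .cons hxy.symm p, ?_, fun u => ?_, fun e h => ?_⟩
  · rw [Walk.cons_isCycle_iff]
    refine ⟨hp, fun hmem => ?_⟩
    cases p with
    | nil => simp at hmem
    | @cons _ b _ hb q =>
      rw [Walk.cons_isPath_iff] at hp
      rw [Walk.edges_cons, List.mem_cons] at hmem
      rcases hmem with hmem | hmem
      · have hyb : y = b := by
          rw [Sym2.eq_iff] at hmem
          rcases hmem with h | h
          · exact absurd h.1 hxy.ne'
          · exact h.1
        subst hyb
        obtain rfl := Walk.eq_nil_iff_nil.2 (Walk.isPath_iff_nil.1 hp.1)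
        have := (hs v).2 hv
        simp [hvx, hvy] at this
      · exact hp.2 (q.snd_mem_support_of_mem_edges hmem)
  · rw [Walk.support_cons, List.mem_cons, ← hs]
    exact ⟨fun h => h.elim (fun h => h ▸ p.end_mem_support) id, .inr⟩
  · exact List.mem_cons_of_mem _ (he e h)

theorem Walk.exists_eq_append_cons {a b : V} (p : G.Walk a b) {d : G.Dart} (hd : d ∈ p.darts) :
    ∃ (q : G.Walk a d.fst) (r : G.Walk d.snd b), p = q.append (.cons d.adj r) := by
  induction p with
  | nil => simp at hd
  | cons h p ih =>
    rw [Walk.darts_cons, List.mem_cons] at hd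
    rcases hd with rfl | hd
    · exact ⟨.nil, p, rfl⟩
    · obtain ⟨q, r, rfl⟩ := ih hd
      exact ⟨.cons h q, r, rfl⟩

/-- Removing an edge `xy` from a cycle leaves a path from `y` to `x`. -/
theorem Walk.IsCycle.isPathOn_sdiff {a : V} {p : G.Walk a a} (hp : p.IsCycle)
    (hxy : s(x, y) ∈ p.edges) :
    G.IsPathOn {v | v ∈ p.support} {e | e ∈ p.edges ∧ e ≠ s(x, y)} y x := by
  -- A cycle may traverse the edge in either direction; reversing the walk reduces to one.
  have key : ∀ {x y : V} {p : G.Walk a a}, p.IsCycle → ∀ d ∈ p.darts, d.fst = x → d.snd = y →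
      G.IsPathOn {v | v ∈ p.support} {e | e ∈ p.edges ∧ e ≠ s(x, y)} y x := by
    rintro x y p hp d hd rfl rfl
    obtain ⟨q, r, rfl⟩ := p.exists_eq_append_cons hd
    refine ⟨r.append q, ?_, fun v => ?_, fun e he => ?_⟩
    · have := hp.support_nodup
      rw [Walk.support_append, Walk.support_cons, List.tail_cons, List.tail_append_of_ne_nil
        q.support_ne_nil] at this
      rw [Walk.isPath_def, Walk.support_append]
      exact List.perm_append_comm.nodup this
    · change _ ↔ v ∈ (q.append (.cons d.adj r)).support
      rw [Walk.mem_support_append_iff, Walk.mem_support_append_iff, Walk.support_cons,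
        List.mem_cons]
      refine ⟨fun h => by tauto, ?_⟩
      rintro (h | rfl | h)
      · exact .inr h
      · exact .inr q.end_mem_support
      · exact .inl h
    · have h1 := he.1
      rw [Walk.edges_append, Walk.edges_cons, List.mem_append, List.mem_cons] at h1
      rw [Walk.edges_append, List.mem_append]
      rcases h1 with h | h | h
      · exact .inr h
      · exact absurd h he.2
      · exact .inl h
  obtain ⟨d, hd, hde⟩ := List.mem_map.1 hxy
  replace hde : s(d.fst, d.snd) = s(x, y) := hde
  rw [Sym2.eq_iff] at hde
  rcases hde with h | h
  · exact key hp d hd h.1 h.2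
  · have := key (p := p.reverse) (x := x) (y := y) hp.reverse d.symm (by simpa using hd)
      h.2 h.1
    exact this.mono (by simp) (by simp)

/-- Two disjoint cycles through edges `xy` and `zw` can be merged along edges `xz` and `yw`. -/
theorem IsCycleOn.merge (h : G.IsCycleOn S E) (h' : G.IsCycleOn T F) (hST : Disjoint S T)
    (hxy : s(x, y) ∈ E) (hzw : s(z, w) ∈ F) (hxz : G.Adj x z) (hyw : G.Adj y w) :
    G.IsCycleOn (S ∪ T) (E \ {s(x, y)} ∪ F \ {s(z, w)}) := by
  obtain ⟨a, p, hp, hs, he⟩ := h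
  obtain ⟨b, q, hq, hs', he'⟩ := h'
  have hP := (hp.isPathOn_sdiff (he _ hxy)).mono (T := S) (F := E \ {s(x, y)})
    (fun v => (hs v).symm) (fun e h => ⟨he e h.1, h.2⟩)
  have hQ := (hq.isPathOn_sdiff (x := w) (y := z) (Sym2.eq_swap ▸ he' _ hzw)).mono (T := T)
    (F := F \ {s(z, w)}) (fun v => (hs' v).symm)
    (fun e h => ⟨he' e h.1, by rw [Sym2.eq_swap]; exact h.2⟩)
  have hx : x ∈ S := (hs x).1 (p.fst_mem_support_of_mem_edges (he _ hxy))
  have hw : w ∈ T := (hs' w).1 (q.snd_mem_support_of_mem_edges (he' _ hzw))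
  refine ((hP.append hQ hxz hST).close hyw ⟨x, .inl hx, ?_, ?_⟩).mono (fun _ => Iff.rfl)
    (Set.subset_insert _ _)
  · exact (p.adj_of_mem_edges (he _ hxy)).ne
  · exact fun h => Set.disjoint_left.1 hST hx (h ▸ hw)

theorem IsCycleOn.hasHamiltonianCycle [DecidableEq V] (h : G.IsCycleOn Set.univ E) :
    G.HasHamiltonianCycle := by
  obtain ⟨a, p, hp, hs, -⟩ := h
  refine ⟨a, p, hp, ?_⟩
  refine hp.isPath_tail.isHamiltonian_of_mem fun v => ?_
  rw [p.support_tail_of_not_nil hp.not_nil]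
  have hv := (hs v).2 trivial
  rw [← Walk.cons_tail_support, List.mem_cons] at hv
  rcases hv with rfl | hv
  · exact Walk.end_mem_tail_support hp.not_nil
  · exact hv

end SimpleGraph

/-! ### Cycles on two and three adjacent columns. -/

namespace SimpleGraph

variable {V₁ V₂ : Type*} {G₁ : SimpleGraph V₁} {G₂ : SimpleGraph V₂} {f : ℕ → V₁} {n : ℕ}

/-- `f 0, …, f (n - 1)` are the successive vertices of a Hamiltonian path of `G`. -/
structure IsPathEnum (G : SimpleGraph V₁) (f : ℕ → V₁) (n : ℕ) : Prop where
  inj : ∀ i < n, ∀ j < n, f i = f j → i = j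
  surj : ∀ x, ∃ i < n, f i = x
  adj : ∀ i, i + 1 < n → G.Adj (f i) (f (i + 1))

theorem IsTraceable.exists_isPathEnum [Fintype V₁] [DecidableEq V₁] (h : G₁.IsTraceable) :
    ∃ f, G₁.IsPathEnum f (Fintype.card V₁) := by
  obtain ⟨a, b, p, hp⟩ := h
  have hl := hp.length_support
  rw [Walk.length_support] at hl
  refine ⟨p.getVert, fun i hi j hj hij => ?_, fun x => ?_, fun i hi => ?_⟩
  · exact hp.isPath.getVert_injOn (show i ≤ p.length by omega) (show j ≤ p.length by omega) hij
  · obtain ⟨i, hi, hil⟩ := Walk.mem_support_iff_exists_getVert.1 (hp.mem_support x)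
    exact ⟨i, by omega, hi⟩
  · exact p.adj_getVert_succ (by omega)

/-- The edge between rows `j` and `j + 1` in the column of `v`. -/
def columnEdge (f : ℕ → V₁) (v : V₂) (j : ℕ) : Sym2 (V₁ × V₂) :=
  s((f j, v), (f (j + 1), v))

theorem IsPathEnum.columnEdge_inj (hf : G₁.IsPathEnum f n) {v w : V₂} {i j : ℕ} (hi : i + 1 < n)
    (hj : j + 1 < n) (h : columnEdge f v i = columnEdge f w j) : v = w ∧ i = j := by
  simp only [columnEdge, Sym2.eq_iff, Prod.mk.injEq] at h
  rcases h with h | h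
  · exact ⟨h.1.2, hf.inj _ (by omega) _ (by omega) h.1.1⟩
  · have h1 := hf.inj _ (by omega) _ (by omega) h.1.1
    have h2 := hf.inj _ (by omega) _ (by omega) h.2.1
    omega

theorem IsPathEnum.boxProd_adj_row (hf : G₁.IsPathEnum f n) {i : ℕ} (hi : i + 1 < n) (v : V₂) :
    (G₁ □ G₂).Adj (f i, v) (f (i + 1), v) := by
  simp [boxProd_adj, hf.adj i hi]

theorem boxProd_adj_column (x : V₁) {v w : V₂} (h : G₂.Adj v w) :
    (G₁ □ G₂).Adj (x, v) (x, w) := by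
  simp [boxProd_adj, h]

theorem IsPathEnum.notMem_rows (hf : G₁.IsPathEnum f n) {i m : ℕ} (hi : i < n) (hm : m < i)
    (B : Set V₂) (v : V₂) : (f i, v) ∉ {z : V₁ × V₂ | (∃ j ≤ m, z.1 = f j) ∧ z.2 ∈ B} := by
  rintro ⟨⟨j, hj, h⟩, -⟩
  have := hf.inj _ hi _ (by omega) h
  omega

theorem IsPathEnum.mem_rows (hf : G₁.IsPathEnum f n) (B : Set V₂) (z : V₁ × V₂) :
    z ∈ {z : V₁ × V₂ | z.2 ∈ B} ↔ z ∈ {z : V₁ × V₂ | (∃ j ≤ n - 1, z.1 = f j) ∧ z.2 ∈ B} := by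
  obtain ⟨i, hi, h⟩ := hf.surj z.1
  exact ⟨fun hz => ⟨⟨i, by omega, h.symm⟩, hz⟩, fun hz => hz.2⟩

theorem mem_rows_succ {m : ℕ} {B : Set V₂} {z : V₁ × V₂} :
    z ∈ {z : V₁ × V₂ | (∃ j ≤ m + 1, z.1 = f j) ∧ z.2 ∈ B} ↔
      z ∈ {z : V₁ × V₂ | (∃ j ≤ m, z.1 = f j) ∧ z.2 ∈ B} ∨ z.1 = f (m + 1) ∧ z.2 ∈ B := by
  constructor
  · rintro ⟨⟨j, hj, h⟩, hz⟩
    rcases Nat.lt_or_ge m j with hjm | hjm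
    · obtain rfl : j = m + 1 := by omega
      exact .inr ⟨h, hz⟩
    · exact .inl ⟨⟨j, hjm, h⟩, hz⟩
  · rintro (⟨⟨j, hj, h⟩, hz⟩ | ⟨h, hz⟩)
    · exact ⟨⟨j, by omega, h⟩, hz⟩
    · exact ⟨⟨_, le_rfl, h⟩, hz⟩

section TwoColumns

variable {u v : V₂}

theorem IsPathEnum.isPathOn_two_columns (hf : G₁.IsPathEnum f n) (huv : G₂.Adj u v) (m : ℕ)
    (hm : m < n) :
    (G₁ □ G₂).IsPathOn {z | (∃ i ≤ m, z.1 = f i) ∧ z.2 ∈ ({u, v} : Set V₂)}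
      {e | ∃ j < m, e = columnEdge f u j ∨ e = columnEdge f v j} (f m, u) (f m, v) := by
  induction m with
  | zero =>
    refine ((isPathOn_singleton _).cons (boxProd_adj_column _ huv) (by simp [huv.ne])).mono ?_
      (by simp)
    rintro ⟨x, w⟩
    simp
    tauto
  | succ m ih =>
    refine (((ih (by omega)).cons (w := (f (m + 1), u)) (hf.boxProd_adj_row hm u).symm
      (hf.notMem_rows hm (by omega) _ _)).concat (w := (f (m + 1), v)) (hf.boxProd_adj_row hm v)
      ?_).mono (fun z => ?_) ?_
    · rw [Set.mem_insert_iff, not_or]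
      exact ⟨by simp [huv.ne'], hf.notMem_rows hm (by omega) _ _⟩
    · obtain ⟨x, w⟩ := z
      rw [mem_rows_succ]
      simp only [Set.mem_insert_iff, Prod.mk.injEq, Set.mem_singleton_iff]
      tauto
    · rintro e ⟨j, hj, he⟩
      rcases Nat.lt_succ_iff_lt_or_eq.1 hj with hj | rfl
      · exact .inr (.inr ⟨j, hj, he⟩)
      · rcases he with rfl | rfl
        · exact .inr (.inl Sym2.eq_swap)
        · exact .inl rfl

theorem IsPathEnum.isCycleOn_two_columns (hf : G₁.IsPathEnum f n) (huv : G₂.Adj u v)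
    (hn : 2 ≤ n) :
    (G₁ □ G₂).IsCycleOn {z | z.2 ∈ ({u, v} : Set V₂)}
      {e | ∃ w ∈ ({u, v} : Set V₂), ∃ j < n - 1, e = columnEdge f w j} := by
  refine ((hf.isPathOn_two_columns huv (n - 1) (by omega)).close (boxProd_adj_column _ huv)
    ⟨(f 0, u), ⟨⟨0, by omega, rfl⟩, by simp⟩, ?_, by simp [huv.ne]⟩).mono
    (hf.mem_rows _) ?_
  · intro h
    have := hf.inj _ (by omega) _ (by omega) (congrArg Prod.fst h)
    omega
  · rintro e ⟨w, rfl | rfl, j, hj, rfl⟩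
    · exact ⟨j, hj, .inl rfl⟩
    · exact ⟨j, hj, .inr rfl⟩

end TwoColumns

section ThreeColumns

variable {a b c : V₂}

/-- Two more rows: the `a` end runs straight down, while the `c` end goes down, across to `b`, down,
and back to `c`. -/
theorem IsPathEnum.isPathOn_three_columns_step (hf : G₁.IsPathEnum f n) (hab : G₂.Adj a b)
    (hbc : G₂.Adj b c) (hac : a ≠ c) {B : Set V₂} (hB : ∀ v, v ∈ B ↔ v = a ∨ v = b ∨ v = c)
    {m : ℕ} (hm : m + 2 < n) {E : Set (Sym2 (V₁ × V₂))}
    (h : (G₁ □ G₂).IsPathOn {z | (∃ i ≤ m, z.1 = f i) ∧ z.2 ∈ B} E (f m, a) (f m, c)) :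
    (G₁ □ G₂).IsPathOn {z | (∃ i ≤ m + 2, z.1 = f i) ∧ z.2 ∈ B}
      (E ∪ {columnEdge f a m, columnEdge f c m, columnEdge f a (m + 1), columnEdge f b (m + 1)})
      (f (m + 2), a) (f (m + 2), c) := by
  have h1 := hf.boxProd_adj_row (G₂ := G₂) (i := m) (by omega)
  have h2 := hf.boxProd_adj_row (G₂ := G₂) (i := m + 1) hm
  have h12 : f (m + 2) ≠ f (m + 1) := fun h => by
    have := hf.inj _ (by omega) _ (by omega) h
    omega
  have k1 := hf.notMem_rows (i := m + 1) (m := m) (by omega) (by omega) B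
  have k2 := hf.notMem_rows (i := m + 2) (m := m) hm (by omega) B
  refine ((((((h.cons (h1 a).symm (k1 a)).concat (h1 c) ?_).concat
    (boxProd_adj_column _ hbc.symm) ?_).concat (h2 b) ?_).concat
    (boxProd_adj_column _ hbc) ?_).cons (h2 a).symm ?_).mono (fun z => ?_) ?_
  · simp only [Set.mem_insert_iff, k1, or_false, Prod.mk.injEq, true_and]
    exact hac.symm
  · simp [k1, hbc.ne, hab.ne', -Set.mem_ofPred_eq]
  · simp [k2, h12, -Set.mem_ofPred_eq]
  · simp [k2, h12, hbc.ne', -Set.mem_ofPred_eq]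
  · simp [k2, h12, hab.ne, hac, -Set.mem_ofPred_eq]
  · obtain ⟨x, w⟩ := z
    rw [mem_rows_succ, mem_rows_succ]
    simp only [Set.mem_insert_iff, Prod.mk.injEq, hB]
    tauto
  · rintro e (he | rfl | rfl | rfl | rfl)
    · simp [he]
    · simp [columnEdge, Sym2.eq_swap]
    · simp [columnEdge]
    · exact .inl Sym2.eq_swap
    · simp [columnEdge]

/-- The column edges used by the standard cycle on three columns. -/
def threeColumnEdges (f : ℕ → V₁) (a b c : V₂) (m : ℕ) : Set (Sym2 (V₁ × V₂)) :=
  {e | ∃ j < m, (j % 2 = 0 ∨ j % 4 = 1) ∧ e = columnEdge f a j ∨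
    j % 2 = 1 ∧ e = columnEdge f b j ∨ (j % 2 = 0 ∨ j % 4 = 3) ∧ e = columnEdge f c j}

theorem IsPathEnum.isPathOn_three_columns (hf : G₁.IsPathEnum f n) (hab : G₂.Adj a b)
    (hbc : G₂.Adj b c) (hac : a ≠ c) (m : ℕ) (hm : 2 * m < n) :
    (G₁ □ G₂).IsPathOn {z | (∃ i ≤ 2 * m, z.1 = f i) ∧ z.2 ∈ ({a, b, c} : Set V₂)}
      (threeColumnEdges f a b c (2 * m)) (f (2 * m), a) (f (2 * m), c) := by
  induction m with
  | zero =>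
    refine (((isPathOn_singleton (f 0, c)).cons (boxProd_adj_column _ hbc)
      (by simp [hbc.ne])).cons (boxProd_adj_column _ hab) (by simp [hab.ne, hac])).mono ?_
      (by simp [threeColumnEdges])
    rintro ⟨x, w⟩
    simp
    tauto
  | succ m ih =>
    rcases Nat.even_or_odd m with hpar | hpar
    · refine (hf.isPathOn_three_columns_step hab hbc hac (by simp) hm (ih (by omega))).mono
        (fun _ => Iff.rfl) ?_
      rw [Nat.even_iff] at hpar
      rintro e ⟨j, hj, he⟩
      rcases (by omega : j < 2 * m ∨ j = 2 * m ∨ j = 2 * m + 1) with hj | rfl | rfl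
      · exact .inl ⟨j, hj, he⟩
      · rcases he with he | he | he
        · simp [he.2]
        · omega
        · simp [he.2]
      · rcases he with he | he | he
        · simp [he.2]
        · simp [he.2]
        · omega
    -- For odd `m` the detour is mirrored, with `a` and `c` exchanged; the alternation gives the
    -- period 4 and keeps either outer column from losing all its odd edges.
    · refine (hf.isPathOn_three_columns_step hbc.symm hab.symm hac.symm (by simp; tauto) hm
        (ih (by omega)).symm).symm.mono (fun _ => Iff.rfl) ?_
      rw [Nat.odd_iff] at hpar
      rintro e ⟨j, hj, he⟩
      rcases (by omega : j < 2 * m ∨ j = 2 * m ∨ j = 2 * m + 1) with hj | rfl | rfl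
      · exact .inl ⟨j, hj, he⟩
      · rcases he with he | he | he
        · simp [he.2]
        · omega
        · simp [he.2]
      · rcases he with he | he | he
        · omega
        · simp [he.2]
        · simp [he.2]

/-- The snake ends in an even row `2 * m`; as `n` is even, exactly one row is left, and it closes
the cycle. -/
theorem IsPathEnum.isCycleOn_three_columns (hf : G₁.IsPathEnum f n) (hab : G₂.Adj a b)
    (hbc : G₂.Adj b c) (hac : a ≠ c) (hn : 2 ≤ n) (hpar : Even n) :
    (G₁ □ G₂).IsCycleOn {z | z.2 ∈ ({a, b, c} : Set V₂)} (threeColumnEdges f a b c (n - 1)) := by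
  obtain ⟨m, rfl⟩ : ∃ m, n = 2 * m + 2 := by
    obtain ⟨k, hk⟩ := hpar
    exact ⟨k - 1, by omega⟩
  have h1 := hf.boxProd_adj_row (G₂ := G₂) (i := 2 * m) (by omega)
  have k1 := hf.notMem_rows (i := 2 * m + 1) (m := 2 * m) (by omega) (by omega) {a, b, c}
  refine ((((hf.isPathOn_three_columns hab hbc hac m (by omega)).cons (h1 a).symm (k1 a)).concat
    (h1 c) ?_).concat (w := (f (2 * m + 1), b)) (boxProd_adj_column _ hbc.symm) ?_ |>.close
    (boxProd_adj_column _ hab) ⟨(f (2 * m + 1), c), ?_, ?_, ?_⟩).mono (fun z => ?_) ?_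
  · simpa [hac.symm, -Set.mem_ofPred_eq] using k1 c
  · simpa [hbc.ne, hab.ne', -Set.mem_ofPred_eq] using k1 b
  · simp
  · simp [hac.symm]
  · simp [hbc.ne']
  · rw [hf.mem_rows {a, b, c} z, show 2 * m + 2 - 1 = 2 * m + 1 from rfl, mem_rows_succ]
    obtain ⟨x, w⟩ := z
    simp only [Set.mem_insert_iff, Prod.mk.injEq, Set.mem_singleton_iff]
    tauto
  · rintro e ⟨j, hj, he⟩
    rcases (by omega : j < 2 * m ∨ j = 2 * m) with hj | rfl
    · exact .inr (.inr (.inr ⟨j, hj, he⟩))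
    · rcases he with he | he | he
      · simp [he.2, columnEdge, Sym2.eq_swap]
      · omega
      · simp [he.2, columnEdge]

end ThreeColumns

end SimpleGraph

/-! ### Merging the cycles of all blocks. -/

namespace SimpleGraph

open Finset

variable {V₁ V₂ : Type*} {G₁ : SimpleGraph V₁} {G₂ : SimpleGraph V₂} {f : ℕ → V₁} {n : ℕ}

theorem Connected.exists_adj_mem_notMem {V : Type*} {G : SimpleGraph V} (hG : G.Connected)
    {S : Set V} {a b : V} (ha : a ∈ S) (hb : b ∉ S) : ∃ x ∈ S, ∃ y ∉ S, G.Adj x y := by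
  obtain ⟨p⟩ := hG.preconnected a b
  obtain ⟨d, -, h1, h2⟩ := p.exists_boundary_dart S ha hb
  exact ⟨_, h1, _, h2, d.adj⟩

/-- If the columns of `G₁ □ G₂` are partitioned into blocks that each carry a cycle, and
adjacent columns share enough column edges of these cycles, then the cycles can be merged. -/
theorem IsPathEnum.hasHamiltonianCycle_of_blocks [Fintype V₂] [DecidableRel G₂.Adj]
    [DecidableEq V₁] [DecidableEq V₂]
    (hf : G₁.IsPathEnum f n) (hG₂ : G₂.Connected) {κ : Type*} (blk : V₂ → κ)
    (A : V₂ → Finset ℕ) (hAn : ∀ v, ∀ j ∈ A v, j + 1 < n)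
    (hA : ∀ v w, G₂.Adj v w → G₂.maxDegree ≤ #(A v ∩ A w) + 1)
    (hcyc : ∀ v, (G₁ □ G₂).IsCycleOn {z | blk z.2 = blk v}
      {e | ∃ w, blk w = blk v ∧ ∃ j ∈ A w, e = columnEdge f w j})
    (hnbr : ∀ v, ∃ w, G₂.Adj v w ∧ blk w = blk v) :
    (G₁ □ G₂).HasHamiltonianCycle := by
  classical
  -- `U w` holds the column edges over `w` spent so far. Each is charged to a neighbour of `w` in
  -- `S`, with one neighbour, from its own block, always left over.
  let Good : Finset V₂ → Prop := fun S => S.Nonempty ∧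
    (∀ v ∈ S, ∀ w, blk w = blk v → w ∈ S) ∧ ∃ U : V₂ → Finset ℕ,
      (∀ w ∈ S, #(U w) + 1 ≤ #(G₂.neighborFinset w ∩ S)) ∧
      (G₁ □ G₂).IsCycleOn {z | z.2 ∈ S} {e | ∃ w ∈ S, ∃ j ∈ A w \ U w, e = columnEdge f w j}
  have hbase : ∃ S, Good S := by
    obtain ⟨v⟩ := hG₂.nonempty
    refine ⟨({w | blk w = blk v} : Finset V₂), ⟨v, by simp⟩, ?_, fun _ => ∅, ?_, ?_⟩
    · intro x hx w hw
      simpa [hw] using hx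
    · intro w hw
      obtain ⟨x, hx, hxw⟩ := hnbr w
      rw [card_empty, zero_add, Nat.succ_le_iff, card_pos]
      refine ⟨x, ?_⟩
      simp only [mem_filter_univ] at hw
      simp [hx, hxw, hw]
    · refine (hcyc v).mono (by simp) ?_
      rintro e ⟨w, hw, j, hj, rfl⟩
      exact ⟨w, by simpa using hw, j, by simpa using hj, rfl⟩
  obtain ⟨S, hS⟩ := (Set.toFinite {S | Good S}).exists_maximal hbase
  obtain ⟨⟨⟨v₀, hv₀⟩, hclosed, U, hU, hC⟩, hmax⟩ := hS
  by_cases hall : ∀ v, v ∈ S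
  · exact (hC.mono (T := Set.univ) (by simp [hall]) subset_rfl).hasHamiltonianCycle
  exfalso
  push Not at hall
  obtain ⟨v₁, hv₁⟩ := hall
  obtain ⟨w, hw, u, hu, hwu⟩ := hG₂.exists_adj_mem_notMem (S := S) hv₀ hv₁
  rw [mem_coe] at hw hu
  -- The neighbour `u` lies outside `S`, so at most `Δ - 2` edges over `w` are spent, while `w` and
  -- `u` share at least `Δ - 1`.
  have hcard : #(U w) < #(A w ∩ A u) := by
    have h1 := hU w hw
    have h2 := hA w u hwu
    have h3 := G₂.degree_le_maxDegree w
    rw [← card_neighborFinset_eq_degree] at h3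
    have h4 : #(G₂.neighborFinset w ∩ S) < #(G₂.neighborFinset w) :=
      card_lt_card ⟨inter_subset_left, fun h =>
        hu (mem_inter.1 (h ((G₂.mem_neighborFinset w u).2 hwu))).2⟩
    omega
  obtain ⟨j, hj, hjU⟩ := exists_mem_notMem_of_card_lt_card hcard
  rw [mem_inter] at hj
  have hblk : ∀ x ∈ S, blk x ≠ blk u := fun x hx h => hu (hclosed x hx u h.symm)
  let S' : Finset V₂ := S ∪ ({x | blk x = blk u} : Finset V₂)
  have hS' : ∀ x, x ∈ S' ↔ x ∈ S ∨ blk x = blk u := by simp [S']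
  let U₀ : V₂ → Finset ℕ := fun x => if x ∈ S then U x else ∅
  let U' : V₂ → Finset ℕ := fun x => if x = w ∨ x = u then insert j (U₀ x) else U₀ x
  have hU₀ : ∀ x, U₀ x ⊆ U' x := by
    intro x
    simp only [U']
    split_ifs
    · exact subset_insert _ _
    · exact subset_rfl
  have hgood : Good S' := by
    refine ⟨⟨v₀, (hS' _).2 (.inl hv₀)⟩, ?_, U', ?_, ?_⟩
    · intro x hx y hy
      rw [hS'] at hx ⊢
      rcases hx with hx | hx
      · exact .inl (hclosed x hx y hy)
      · exact .inr (hy.trans hx)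
    · intro x hx
      rw [hS'] at hx
      have hmono : #(G₂.neighborFinset x ∩ S) ≤ #(G₂.neighborFinset x ∩ S') :=
        card_le_card (inter_subset_inter_left subset_union_left)
      by_cases hxS : x ∈ S
      · have hxu : x ≠ u := fun h => hu (h ▸ hxS)
        have h1 := hU x hxS
        by_cases hxw : x = w
        · subst hxw
          have h2 : U' x = insert j (U x) := by simp [U', U₀, hxS]
          have h3 : insert u (G₂.neighborFinset x ∩ S) ⊆ G₂.neighborFinset x ∩ S' := by
            intro y hy
            rw [mem_insert, mem_inter] at hy
            rw [mem_inter, hS']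
            rcases hy with rfl | hy
            · exact ⟨(G₂.mem_neighborFinset _ _).2 hwu, .inr rfl⟩
            · exact ⟨hy.1, .inl hy.2⟩
          have h4 := card_le_card h3
          rw [card_insert_of_notMem (by simp [hu])] at h4
          rw [h2]
          have := card_insert_le j (U x)
          omega
        · have h2 : U' x = U x := by simp [U', U₀, hxS, hxw, hxu]
          rw [h2]
          omega
      · have hxu := hx.resolve_left hxS
        have hxw : x ≠ w := fun h => hxS (h ▸ hw)
        obtain ⟨y, hxy, hy⟩ := hnbr x
        have hyS : y ∈ G₂.neighborFinset x ∩ S' := by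
          simp [hS', hxy, hy, hxu]
        by_cases hxu' : x = u
        · subst hxu'
          have h2 : U' x = {j} := by simp [U', U₀, hxS]
          -- The new column `u` has spent one edge and has two neighbours in `S'`: `w`, and `y` in
          -- its own block.
          have h3 : ({w, y} : Finset V₂) ⊆ G₂.neighborFinset x ∩ S' := by
            intro z hz
            rw [mem_insert, mem_singleton] at hz
            rcases hz with rfl | rfl
            · simp [hS', hwu.symm, hw]
            · exact hyS
          have h4 := card_le_card h3
          rw [card_pair (fun h => hblk w hw ((congrArg blk h).trans hy))] at h4
          rwa [h2, card_singleton]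
        · have h2 : U' x = ∅ := by simp [U', U₀, hxS, hxw, hxu']
          rw [h2, card_empty, zero_add, Nat.succ_le_iff, card_pos]
          exact ⟨y, hyS⟩
    · have hdisj : Disjoint {z : V₁ × V₂ | z.2 ∈ S} {z | blk z.2 = blk u} :=
        Set.disjoint_left.2 fun z hz hz' => hblk _ hz hz'
      have hM := hC.merge (hcyc u) hdisj (x := (f j, w)) (y := (f (j + 1), w)) (z := (f j, u))
        (w := (f (j + 1), u)) ⟨w, hw, j, mem_sdiff.2 ⟨hj.1, hjU⟩, rfl⟩ ⟨u, rfl, j, hj.2, rfl⟩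
        (boxProd_adj_column _ hwu) (boxProd_adj_column _ hwu)
      refine hM.mono (fun z => by simp [hS']) ?_
      rintro e ⟨x, hx, i, hi, rfl⟩
      rw [mem_sdiff] at hi
      have hne : x = w ∨ x = u → i ≠ j := by
        rintro h rfl
        refine hi.2 ?_
        simp [U', h]
      rw [hS'] at hx
      rcases hx with hx | hx
      · refine .inl ⟨⟨x, hx, i, mem_sdiff.2 ⟨hi.1, fun h => hi.2 (hU₀ x ?_)⟩, rfl⟩, fun h => ?_⟩
        · simpa [U₀, hx] using h
        · obtain ⟨rfl, rfl⟩ := hf.columnEdge_inj (hAn _ _ hi.1) (hAn _ _ hj.1) h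
          exact hne (.inl rfl) rfl
      · refine .inr ⟨⟨x, hx, i, hi.1, rfl⟩, fun h => ?_⟩
        obtain ⟨rfl, rfl⟩ := hf.columnEdge_inj (hAn _ _ hi.1) (hAn _ _ hj.2) h
        exact hne (.inr rfl) rfl
  exact hu (hmax hgood subset_union_left ((hS' u).2 (.inr rfl)))

end SimpleGraph

/-! ### Choosing the blocks under hypotheses (a) and (b). -/

namespace SimpleGraph

open Finset

variable {V₁ V₂ : Type*} {G₁ : SimpleGraph V₁} {G₂ : SimpleGraph V₂} {f : ℕ → V₁} {n : ℕ}

/-- A connected graph of maximum degree at most one with a perfect matching is a single edge. -/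
theorem Connected.card_eq_two_of_maxDegree_le_one [Fintype V₂] [DecidableRel G₂.Adj]
    (hG₂ : G₂.Connected) (hΔ : G₂.maxDegree ≤ 1) (hM : G₂.HasPerfectMatching) :
    Fintype.card V₂ = 2 := by
  classical
  obtain ⟨M, hM⟩ := hM
  obtain ⟨v⟩ := hG₂.nonempty
  obtain ⟨u, hu, -⟩ := Subgraph.isPerfectMatching_iff.1 hM v
  have hvu : G₂.Adj v u := M.adj_sub hu
  have huniq : ∀ x y z, G₂.Adj x y → G₂.Adj x z → y = z := fun x y z hy hz => by
    have h := (G₂.degree_le_maxDegree x).trans hΔ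
    rw [← card_neighborFinset_eq_degree] at h
    exact card_le_one.1 h y (by simpa using hy) z (by simpa using hz)
  have hall : ∀ x, x ∈ ({v, u} : Finset V₂) := by
    by_contra! h
    obtain ⟨x, hx⟩ := h
    obtain ⟨a, ha, b, hb, hab⟩ := hG₂.exists_adj_mem_notMem (S := (({v, u} : Finset V₂) : Set V₂))
      (a := v) (by simp) hx
    have ha : a = v ∨ a = u := by simpa using ha
    refine hb ?_
    rcases ha with rfl | rfl
    · simp [huniq _ _ _ hab hvu]
    · simp [huniq _ _ _ hab hvu.symm]
  rw [← card_univ, ← eq_univ_iff_forall.2 hall, card_pair hvu.ne]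

theorem IsPathEnum.hasHamiltonianCycle_of_hasPerfectMatching [Fintype V₂] [DecidableRel G₂.Adj]
    [DecidableEq V₁] [DecidableEq V₂] (hf : G₁.IsPathEnum f n) (hn : 2 ≤ n) (hG₂ : G₂.Connected)
    (hM : G₂.HasPerfectMatching) (hΔ : G₂.maxDegree ≤ n) :
    (G₁ □ G₂).HasHamiltonianCycle := by
  obtain ⟨M, hM⟩ := hM
  choose g hg huniq using Subgraph.isPerfectMatching_iff.1 hM
  have hgg : ∀ v, g (g v) = v := fun v => (huniq _ _ (hg v).symm).symm
  have hblk : ∀ v w, s(w, g w) = s(v, g v) ↔ w ∈ ({v, g v} : Set V₂) := by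
    intro v w
    simp only [Sym2.eq_iff, Set.mem_insert_iff, Set.mem_singleton_iff]
    constructor
    · rintro (h | h)
      · exact .inl h.1
      · exact .inr h.1
    · rintro (rfl | rfl)
      · exact .inl ⟨rfl, rfl⟩
      · exact .inr ⟨rfl, hgg v⟩
  refine hf.hasHamiltonianCycle_of_blocks hG₂ (fun v => s(v, g v)) (fun _ => range (n - 1))
    ?_ ?_ ?_ ?_
  · intro v j hj
    rw [mem_range] at hj
    omega
  · intro v w _
    rw [inter_self, card_range]
    omega
  · intro v
    refine (hf.isCycleOn_two_columns (M.adj_sub (hg v)) hn).mono (fun z => hblk v z.2) ?_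
    rintro e ⟨w, hw, j, hj, rfl⟩
    exact ⟨w, (hblk v w).1 hw, j, mem_range.1 hj, rfl⟩
  · intro v
    exact ⟨g v, M.adj_sub (hg v), (hblk v _).2 (by simp)⟩

theorem HasPathFactor.exists_positions (h : G₂.HasPathFactor) :
    ∃ (F : SimpleGraph V₂) (len : F.ConnectedComponent → ℕ) (pos : V₂ → ℕ),
      (∀ v, pos v < len (F.connectedComponentMk v)) ∧ (∀ C, 2 ≤ len C) ∧
      (∀ C, ∀ i < len C, ∃ v, F.connectedComponentMk v = C ∧ pos v = i) ∧
      (∀ v w, F.connectedComponentMk v = F.connectedComponentMk w → pos v = pos w → v = w) ∧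
      (∀ v w, F.connectedComponentMk v = F.connectedComponentMk w → pos v + 1 = pos w →
        G₂.Adj v w) := by
  obtain ⟨F, hF, h⟩ := h
  choose len hlen e using h
  replace e := fun C => (e C).some
  have hpos : ∀ (C : F.ConnectedComponent) (v : V₂) (hv : v ∈ C),
      (e (F.connectedComponentMk v) ⟨v, rfl⟩).val = (e C ⟨v, hv⟩).val := by
    rintro C v rfl
    rfl
  refine ⟨F, len, fun v => (e (F.connectedComponentMk v) ⟨v, rfl⟩).val, fun v => Fin.is_lt _, hlen,
    fun C i hi => ?_, fun v w hvw h => ?_, fun v w hvw h => ?_⟩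
  · obtain ⟨v, hv⟩ := (e C).surjective ⟨i, hi⟩
    refine ⟨v.1, v.2, ?_⟩
    simp only
    rw [hpos C v.1 v.2]
    exact congrArg Fin.val hv
  · simp only at h
    rw [hpos _ v hvw] at h
    exact congrArg Subtype.val ((e _).injective (Fin.ext h))
  · simp only at h
    rw [hpos _ v hvw] at h
    have := (e _).map_adj_iff.1 (pathGraph_adj.2 (.inl h))
    exact hF (((F.connectedComponentMk w).toSimpleGraph_adj hvw rfl).1 this)

/-- The column edges available at a vertex at position `p` in a path on `l` vertices, when the path
is cut into paths on two vertices and, if `l` is odd, a final path on three vertices. -/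
def pathSlots (n l p : ℕ) : Finset ℕ :=
  {j ∈ range (n - 1) | l % 2 = 1 → (p + 3 = l → j % 2 = 0 ∨ j % 4 = 1) ∧
    (p + 2 = l → j % 2 = 1) ∧ (p + 1 = l → j % 2 = 0 ∨ j % 4 = 3)}

/-- In a three-vertex block the outer columns have residues 0, 1, 2 and 0, 2, 3 mod 4, the middle
one 1, 3. So residue 1 serves when neither column is a last one, 3 when neither is a first one, and
0 for a first with a last. -/
theorem le_card_pathSlots_inter {d : ℕ} (hn : 4 * d - 2 ≤ n) (l p l' p' : ℕ) :
    d ≤ #(pathSlots n l p ∩ pathSlots n l' p') + 1 := by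
  obtain ⟨r, hr, h⟩ : ∃ r < 4, ∀ t < d - 1, 4 * t + r ∈ pathSlots n l p ∩ pathSlots n l' p' := by
    simp only [pathSlots, mem_inter, mem_filter, mem_range]
    by_cases h1 : (l % 2 = 1 → p + 1 ≠ l) ∧ (l' % 2 = 1 → p' + 1 ≠ l')
    · exact ⟨1, by omega, fun t ht => by omega⟩
    by_cases h3 : (l % 2 = 1 → p + 3 ≠ l) ∧ (l' % 2 = 1 → p' + 3 ≠ l')
    · exact ⟨3, by omega, fun t ht => by omega⟩
    · exact ⟨0, by omega, fun t ht => by omega⟩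
  have := card_le_card_of_injOn (s := range (d - 1)) (fun t => 4 * t + r)
    (fun t ht => h t (by simpa using ht)) (fun a _ b _ hab => by simp only at hab; omega)
  rw [card_range] at this
  omega

theorem IsPathEnum.hasHamiltonianCycle_of_hasPathFactor [Fintype V₂] [DecidableRel G₂.Adj]
    [DecidableEq V₁] [DecidableEq V₂] (hf : G₁.IsPathEnum f n) (hn : 2 ≤ n) (hpar : Even n)
    (hG₂ : G₂.Connected) (hF : G₂.HasPathFactor) (hΔ : 4 * G₂.maxDegree - 2 ≤ n) :
    (G₁ □ G₂).HasHamiltonianCycle := by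
  obtain ⟨F, len, pos, hpos, hlen, hsurj, hinj, hadj⟩ := hF.exists_positions
  let comp : V₂ → F.ConnectedComponent := F.connectedComponentMk
  -- Consecutive positions are paired; the `min` puts the last vertex of an odd path into the
  -- preceding pair.
  let idx : V₂ → ℕ := fun v => min (pos v / 2) (len (comp v) / 2 - 1)
  have hmem : ∀ v w, (comp w, idx w) = (comp v, idx v) ↔ comp w = comp v ∧
      min (pos w / 2) (len (comp v) / 2 - 1) = idx v := by
    intro v w
    rw [Prod.mk.injEq]
    refine and_congr_right fun h => ?_
    rw [← h]
  refine hf.hasHamiltonianCycle_of_blocks hG₂ (fun v => (comp v, idx v))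
    (fun v => pathSlots n (len (comp v)) (pos v)) ?_
    (fun v w _ => le_card_pathSlots_inter hΔ _ _ _ _) ?_ ?_
  · intro v j hj
    have := mem_range.1 (mem_filter.1 hj).1
    omega
  · intro v
    have hv := hpos v
    have hl := hlen (comp v)
    have hiv : idx v = min (pos v / 2) (len (comp v) / 2 - 1) := rfl
    change pos v < len (comp v) at hv
    obtain ⟨a, hac, ha⟩ := hsurj (comp v) (2 * idx v) (by omega)
    obtain ⟨b, hbc, hb⟩ := hsurj (comp v) (2 * idx v + 1) (by omega)
    have hab := hadj a b (hac.trans hbc.symm) (by omega)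
    by_cases h3 : 2 * idx v + 3 = len (comp v)
    · obtain ⟨c, hcc, hc⟩ := hsurj (comp v) (2 * idx v + 2) (by omega)
      have hbc' := hadj b c (hbc.trans hcc.symm) (by omega)
      have hblk : ∀ w, (comp w, idx w) = (comp v, idx v) ↔ w ∈ ({a, b, c} : Set V₂) := by
        intro w
        rw [hmem]
        constructor
        · rintro ⟨hw, hi⟩
          have := hpos w
          change pos w < len (comp w) at this
          rw [hw] at this
          rcases (by omega : pos w = 2 * idx v ∨ pos w = 2 * idx v + 1 ∨ pos w = 2 * idx v + 2)
            with h | h | h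
          · exact .inl (hinj _ _ (hw.trans hac.symm) (by omega))
          · exact .inr (.inl (hinj _ _ (hw.trans hbc.symm) (by omega)))
          · exact .inr (.inr (hinj _ _ (hw.trans hcc.symm) (by omega)))
        · rintro (rfl | rfl | rfl)
          · exact ⟨hac, by omega⟩
          · exact ⟨hbc, by omega⟩
          · exact ⟨hcc, by omega⟩
      refine (hf.isCycleOn_three_columns hab hbc' (fun h => by subst h; omega) hn hpar).mono
        (fun z => hblk z.2) ?_
      rintro e ⟨w, hw, j, hj, rfl⟩
      rw [pathSlots, mem_filter, mem_range, ((hmem v w).1 hw).1] at hj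
      refine ⟨j, hj.1, ?_⟩
      rcases (hblk w).1 hw with rfl | rfl | rfl
      · exact .inl ⟨(hj.2 (by omega)).1 (by omega), rfl⟩
      · exact .inr (.inl ⟨(hj.2 (by omega)).2.1 (by omega), rfl⟩)
      · exact .inr (.inr ⟨(hj.2 (by omega)).2.2 (by omega), rfl⟩)
    · have hblk : ∀ w, (comp w, idx w) = (comp v, idx v) ↔ w ∈ ({a, b} : Set V₂) := by
        intro w
        rw [hmem]
        constructor
        · rintro ⟨hw, hi⟩
          have := hpos w
          change pos w < len (comp w) at this
          rw [hw] at this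
          rcases (by omega : pos w = 2 * idx v ∨ pos w = 2 * idx v + 1) with h | h
          · exact .inl (hinj _ _ (hw.trans hac.symm) (by omega))
          · exact .inr (hinj _ _ (hw.trans hbc.symm) (by omega))
        · rintro (rfl | rfl)
          · exact ⟨hac, by omega⟩
          · exact ⟨hbc, by omega⟩
      refine (hf.isCycleOn_two_columns hab hn).mono (fun z => hblk z.2) ?_
      rintro e ⟨w, hw, j, hj, rfl⟩
      exact ⟨w, (hblk w).1 hw, j, mem_range.1 (mem_filter.1 hj).1, rfl⟩
  · intro v
    have hv := hpos v
    change pos v < len (comp v) at hv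
    have hl := hlen (comp v)
    have hiv : idx v = min (pos v / 2) (len (comp v) / 2 - 1) := rfl
    by_cases hp : pos v % 2 = 0 ∧ pos v + 1 < len (comp v)
    · obtain ⟨w, hwc, hw⟩ := hsurj (comp v) (pos v + 1) hp.2
      exact ⟨w, hadj v w hwc.symm hw.symm, (hmem v w).2 ⟨hwc, by omega⟩⟩
    · obtain ⟨w, hwc, hw⟩ := hsurj (comp v) (pos v - 1) (by omega)
      exact ⟨w, (hadj w v hwc (by omega)).symm, (hmem v w).2 ⟨hwc, by omega⟩⟩

end SimpleGraph

theorem theorem1p1 {V₁ V₂ : Type*} [Fintype V₁] [DecidableEq V₁] [Fintype V₂] [DecidableEq V₂]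
    (G₁ : SimpleGraph V₁) (G₂ : SimpleGraph V₂) [DecidableRel G₂.Adj]
    (hG₁ : G₁.IsTraceable) (hG₂ : G₂.Connected)
    (hne : ¬ (Fintype.card V₁ = 1 ∧ Fintype.card V₂ = 2))
    (h : (G₂.HasPerfectMatching ∧ G₂.maxDegree ≤ Fintype.card V₁) ∨
      (G₂.HasPathFactor ∧ Even (Fintype.card V₁) ∧
        4 * G₂.maxDegree - 2 ≤ Fintype.card V₁)) :
    (G₁.boxProd G₂).HasHamiltonianCycle := by
  obtain ⟨f, hf⟩ := hG₁.exists_isPathEnum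
  have hpos : 0 < Fintype.card V₁ := by
    obtain ⟨a, -⟩ := hG₁
    exact Fintype.card_pos_iff.2 ⟨a⟩
  rcases h with ⟨hM, hΔ⟩ | ⟨hF, hpar, hΔ⟩
  · have hn : 2 ≤ Fintype.card V₁ := by
      by_contra hlt
      have h1 : Fintype.card V₁ = 1 := by omega
      exact hne ⟨h1, hG₂.card_eq_two_of_maxDegree_le_one (h1 ▸ hΔ) hM⟩
    exact hf.hasHamiltonianCycle_of_hasPerfectMatching hn hG₂ hM hΔ
  · have hn : 2 ≤ Fintype.card V₁ := by
      obtain ⟨k, hk⟩ := hpar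
      omega
    exact hf.hasHamiltonianCycle_of_hasPathFactor hn hpar hG₂ hF hΔ
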